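/- Let $\mathcal M=\langle M,<,+,0,1,\dots\rangle$ be an o-minimal expansion of an ordered abelian group with a distinguished positive element $1$, in the language $\mathcal L$. Let $P\subseteq M$ and $\widetilde{\mathcal M}=\langle \mathcal M,P\rangle$, the expansion of $\mathcal M$ by a unary predicate for $P$. For $A\subseteq M$, "$\mathcal L_A$-definable" means definable in $\mathcal M$ with parameters from $A$, "$\mathcal L$-definable" means $\mathcal L_M$-definable, and "$A$-definable" without further mention of a structure means definable in $\widetilde{\mathcal M}$ with parameters from $A$. Let $\operatorname{dcl}$ be the definable closure in $\mathcal M$. A set $D\subseteq M$ is $\operatorname{dcl}$-independent over $P$ if $d\notin\operatorname{dcl}(P\cup (D\setminus\{d\}))$ for every $d\in D$. For $D\subseteq M$, let $P_{ind(D)}$ be the structure with universe $P$ that has, for every $m$ and every $\mathcal L$-formula $\phi(x_1,\dots,x_m)$ with parameters from $D$, an $m$-ary relation symbol $R_\phi$, interpreted by $P_{ind(D)}\models R_\phi(a)\iff\mathcal M\models\phi(a)$ for $a\in P^m$. Consider the following conditions. - (OP) For every $A\subseteq M$ such that $A\setminus P$ is $\operatorname{dcl}$-independent over $P$, every $n$,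 and every $A$-definable set $V\subseteq M^n$, the topological closure $\overline V\subseteq M^n$ is $\mathcal L_A$-definable. - (ind)$_D$ For every $n$ and every $X\subseteq P^n$ that is definable in $P_{ind(D)}$ with parameters from $P$, there are finitely many $\mathcal L$-definable sets $Y_1,\dots,Y_l\subseteq M^n$ and sets $Q_1,\dots,Q_l\subseteq P^n$ that are $\emptyset$-definable in $P_{ind(D)}$, such that $X=\bigcup_{i=1}^l (Y_i\cap Q_i)$. Corollary. Assume (OP) and (ind)$_D$, and that $D$ is $\operatorname{dcl}$-independent over $P$. Let $A\subseteq P$, and let $X\subseteq P^n$ be $A$-definable in $P_{ind(D)}$. Then there are finitely many $\mathcal L_{A\cup D}$-definable sets $W_1,\dots,W_l\subseteq M^n$ and sets $S_1,\dots,S_l\subseteq P^n$ that are $\emptyset$-definable in $P_{ind(D)}$, such that $$X=\bigcup_{i=1}^l (W_i\cap S_i).$$ -/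

import Mathlib

open FirstOrder Set

universe u v w

/-- The subset `P^n` of `M^n`. -/
def tuplesIn {M : Type w} (P : Set M) (n : ℕ) : Set (Fin n → M) := {x | ∀ i, x i ∈ P}

/-- Points and open intervals with endpoints in `M ∪ {-∞, +∞}`. -/
def IsPointOrOpenInterval {M : Type w} [LinearOrder M] (I : Set M) : Prop :=
  (∃ a, I = {a}) ∨ (∃ a b, I = Ioo a b) ∨ (∃ a, I = Iio a) ∨ (∃ a, I = Ioi a) ∨ I = univ

/-- The `L`-structure on the ordered group `M` is o-minimal and expands `(M, <, +, 0, one)`, where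
`one` is the distinguished positive element: the order, the group operation and `one` are definable
without parameters, and every subset of `M` that is definable with parameters is a finite union of
points and open intervals. (The element `0` is then definable as the solution of `x + x = x`.) -/
structure IsOMinimalExpansion (L : FirstOrder.Language.{u, v}) {M : Type w} [AddCommGroup M] [LinearOrder M]
    [L.Structure M] (one : M) : Prop where
  lt_definable : (∅ : Set M).Definable L {x : Fin 2 → M | x 0 < x 1}
  add_definable : (∅ : Set M).Definable L {x : Fin 3 → M | x 0 + x 1 = x 2}
  one_definable : (∅ : Set M).Definable₁ L {one}
  one_pos : 0 < one
  finite_union : ∀ X : Set M, (univ : Set M).Definable₁ L X →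
    ∃ F : Set (Set M), F.Finite ∧ (∀ I ∈ F, IsPointOrOpenInterval I) ∧ X = ⋃₀ F

/-- The definable closure of `A` in the `L`-structure `M`. -/
def dcl (L : FirstOrder.Language.{u, v}) {M : Type w} [L.Structure M] (A : Set M) : Set M :=
  {x | A.Definable₁ L {x}}

/-- `D` is `dcl`-independent over `P`. -/
def DclIndependentOver (L : FirstOrder.Language.{u, v}) {M : Type w} [L.Structure M] (D P : Set M) : Prop :=
  ∀ d ∈ D, d ∉ dcl L (P ∪ (D \ {d}))

/-- The only relation symbol of the language with one unary predicate. -/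
inductive UnaryPredRel : ℕ → Type
  | mem : UnaryPredRel 1

/-- The language with one unary predicate symbol. -/
def unaryPredLanguage : FirstOrder.Language.{0, 0} := ⟨fun _ => Empty, UnaryPredRel⟩

/-- The interpretation of the unary predicate symbol in `M` by the set `P`. -/
@[reducible]
def unaryPredStructure {M : Type w} (P : Set M) : unaryPredLanguage.Structure M where
  funMap := fun f => f.elim
  RelMap := fun r => match r with
    | UnaryPredRel.mem => fun x => x 0 ∈ P

/-- `X ⊆ M^n` is `A`-definable in the pair `(M, P)`, the expansion of the `L`-structure `M` by a
unary predicate for `P`. -/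
def PairDefinable (L : FirstOrder.Language.{u, v}) {M : Type w} [L.Structure M] (P A : Set M) {n : ℕ}
    (X : Set (Fin n → M)) : Prop :=
  letI := unaryPredStructure P
  A.Definable (L.sum unaryPredLanguage) X

/-- The language of the `D`-induced structure: an `n`-ary relation symbol for every formula in `n`
free variables with parameters from `D`. -/
def inducedLanguage (L : FirstOrder.Language.{u, v}) {M : Type w} (D : Set M) : FirstOrder.Language :=
  ⟨fun _ => Empty, fun n => (L[[D]]).Formula (Fin n)⟩

/-- The `D`-induced structure on `P`: the symbol of a formula `φ` holds at a tuple of elements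
of `P` if and only if `φ` holds at that tuple in `M`. -/
instance inducedStructure (L : FirstOrder.Language.{u, v}) {M : Type w} [L.Structure M] (P D : Set M) :
    (inducedLanguage L D).Structure P where
  funMap := fun f => f.elim
  RelMap := fun {n} (φ : (L[[D]]).Formula (Fin n)) a => φ.Realize (fun i => (a i : M))

/-- `X` is a subset of `P^n` that is definable in the `D`-induced structure on `P` with parameters
from `A` (used for `A ⊆ P`). -/
def InducedDefinable (L : FirstOrder.Language.{u, v}) {M : Type w} [L.Structure M] (P D A : Set M) {n : ℕ}
    (X : Set (Fin n → M)) : Prop :=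
  X ⊆ tuplesIn P n ∧
    ((↑) ⁻¹' A : Set P).Definable (inducedLanguage L D) {x : Fin n → P | (fun i => (x i : M)) ∈ X}

/-- Condition (OP): whenever `A \ P` is `dcl`-independent over `P`, the closure of every set that
is `A`-definable in the pair `(M, P)` is `A`-definable in the `L`-structure `M`. -/
def ConditionOP (L : FirstOrder.Language.{u, v}) {M : Type w} [L.Structure M] [TopologicalSpace M]
    (P : Set M) : Prop :=
  ∀ A : Set M, DclIndependentOver L (A \ P) P →
    ∀ (n : ℕ) (V : Set (Fin n → M)), PairDefinable L P A V → A.Definable L (closure V)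

/-- Condition (ind) for `D`: every subset of `P^n` that is definable with parameters in the
`D`-induced structure is a finite union of traces, of sets definable in the `L`-structure `M` with
parameters, on sets definable without parameters in the `D`-induced structure. -/
def ConditionInd (L : FirstOrder.Language.{u, v}) {M : Type w} [L.Structure M] (P D : Set M) : Prop :=
  ∀ (n : ℕ) (X : Set (Fin n → M)), InducedDefinable L P D P X →
    ∃ (l : ℕ) (Y Q : Fin l → Set (Fin n → M)),
      (∀ i, (univ : Set M).Definable L (Y i)) ∧
      (∀ i, InducedDefinable L P D ∅ (Q i)) ∧
      X = ⋃ i, Y i ∩ Q i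

/-!
Put `C = A ∪ D`. By (ind), `X` is a finite union of sets `Y i ∩ Q i`, where the `Q i` are
`∅`-definable in the induced structure and the `Y i` are members, at one parameter tuple `b ∈ M^k`,
of families of sets that are `∅`-definable in `M`. The set `E ⊆ M^k` of all tuples that give the
same union `X` is `C`-definable in the pair (`InducedDefinable.pairDefinable`), and `C \ P` is
`dcl`-independent over `P`; so by (OP) the closure of `E` is `C`-definable in `M`.

Call a subset of `M^k` big if there are infinitely many `x₁` with infinitely many `x₂`, …, with
infinitely many `x_k` such that `(x₁, …, x_k)` lies in it (`IsBig`).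

* If `closure E` is not big, then some coordinate of `b` is a `C`-definable function of the other
  coordinates (`IsOMinimalExpansion.isBig_or_exists_functional`); substituting this function into
  the families lowers `k`.
* If `closure E` is big, `Y i` is replaced by the set `W i` of those `x` for which the parameters
  `c ∈ closure E` with `x` in the fibre of the family at `c` form a big set. Bigness is definable in
  families, so `W i` is `C`-definable. A big definable set has nonempty interior
  (`IsOMinimalExpansion.interior_nonempty_of_isBig`), so a big definable subset of `closure E` meets
  `E`, and the definition of `E` then yields `X = ⋃ i, W i ∩ Q i`
  (`IsOMinimalExpansion.exists_definable_cover`).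

No cell decomposition is needed for the interior statement: it follows from interchanging the
quantifiers "there are infinitely many" (`IsOMinimalExpansion.infinite_setOf_infinite_swap`), which
rests on the fact that an infinite definable set is not covered by a definable chain of sets meeting
it in finite sets (`IsOMinimalExpansion.exists_infinite_of_chain`).
-/

/-! ### Definable sets described by predicates -/

section Definability

variable {L : FirstOrder.Language.{u, v}} {M : Type w} [L.Structure M] {A : Set M}
  {α β : Type}

theorem definable_not {p : (α → M) → Prop} (hp : A.Definable L {v | p v}) :
    A.Definable L {v | ¬ p v} := hp.compl

theorem definable_and {p q : (α → M) → Prop} (hp : A.Definable L {v | p v})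
    (hq : A.Definable L {v | q v}) : A.Definable L {v | p v ∧ q v} := hp.inter hq

theorem definable_or {p q : (α → M) → Prop} (hp : A.Definable L {v | p v})
    (hq : A.Definable L {v | q v}) : A.Definable L {v | p v ∨ q v} := hp.union hq

theorem definable_imp {p q : (α → M) → Prop} (hp : A.Definable L {v | p v})
    (hq : A.Definable L {v | q v}) : A.Definable L {v | p v → q v} := by
  simpa only [imp_iff_not_or] using definable_or (definable_not hp) hq

theorem definable_iff {p q : (α → M) → Prop} (hp : A.Definable L {v | p v})
    (hq : A.Definable L {v | q v}) : A.Definable L {v | p v ↔ q v} := by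
  simpa only [iff_iff_implies_and_implies] using
    definable_and (definable_imp hp hq) (definable_imp hq hp)

theorem definable_forall_index {ι : Type*} [Finite ι] {p : ι → (α → M) → Prop}
    (hp : ∀ i, A.Definable L {v | p i v}) : A.Definable L {v | ∀ i, p i v} := by
  convert definable_iInter_of_finite hp using 1
  ext v; simp

theorem definable_exists_index {ι : Type*} [Finite ι] {p : ι → (α → M) → Prop}
    (hp : ∀ i, A.Definable L {v | p i v}) : A.Definable L {v | ∃ i, p i v} := by
  convert definable_iUnion_of_finite hp using 1
  ext v; simp

theorem definable_exists_tuple [Finite β] {p : (α → M) → (β → M) → Prop}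
    (hp : A.Definable L {v : α ⊕ β → M | p (fun i => v (.inl i)) (fun j => v (.inr j))}) :
    A.Definable L {v | ∃ u, p v u} := hp.exists_of_finite

theorem definable_forall_tuple [Finite β] {p : (α → M) → (β → M) → Prop}
    (hp : A.Definable L {v : α ⊕ β → M | p (fun i => v (.inl i)) (fun j => v (.inr j))}) :
    A.Definable L {v | ∀ u, p v u} := hp.forall_of_finite

/-- Quantification over one element of `M`; the bound variable is indexed by `none`. -/
theorem definable_exists {p : (α → M) → M → Prop}
    (hp : A.Definable L {v : Option α → M | p (fun i => v (some i)) (v none)}) :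
    A.Definable L {v | ∃ y, p v y} := by
  have h : A.Definable L {v : α ⊕ Unit → M | p (fun i => v (.inl i)) (v (.inr ()))} :=
    hp.preimage_comp (fun o : Option α => o.elim (Sum.inr ()) Sum.inl)
  convert definable_exists_tuple (p := fun v (u : Unit → M) => p v (u ())) h using 1
  ext v
  exact ⟨fun ⟨y, hy⟩ => ⟨fun _ => y, hy⟩, fun ⟨u, hu⟩ => ⟨u (), hu⟩⟩

theorem definable_forall {p : (α → M) → M → Prop}
    (hp : A.Definable L {v : Option α → M | p (fun i => v (some i)) (v none)}) :
    A.Definable L {v | ∀ y, p v y} := by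
  convert definable_not (definable_exists (p := fun v y => ¬ p v y) (definable_not hp)) using 1
  ext v; simp

theorem definable_eq (i j : α) : A.Definable L {v : α → M | v i = v j} :=
  (Set.Definable.diagonal L A).preimage_comp ![i, j]

theorem definable_eq_const {a : M} (ha : a ∈ A) (i : α) : A.Definable L {v : α → M | v i = a} :=
  (Set.Definable.singleton_of_mem L ha).preimage_comp ![i]

/-- Substituting constants for some of the variables preserves definability with parameters. -/
theorem definable_substitute [Finite β] {p : (α → M) → (β → M) → Prop}
    (hp : A.Definable L {v : α ⊕ β → M | p (fun i => v (.inl i)) (fun j => v (.inr j))})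
    (b : β → M) : (univ : Set M).Definable L {v | p v b} := by
  convert definable_exists_tuple (p := fun v u => p v u ∧ ∀ i, u i = b i)
    (definable_and (hp.mono (subset_univ A))
      (definable_forall_index fun i => definable_eq_const (mem_univ _) _)) using 1
  ext v
  refine ⟨fun hv => ⟨b, hv, fun _ => rfl⟩, ?_⟩
  rintro ⟨u, hu, hub⟩
  obtain rfl : u = b := funext hub
  exact hu

theorem definable_fibre [Finite α] {p : (α → M) → M → Prop}
    (hp : A.Definable L {v : Option α → M | p (fun i => v (some i)) (v none)}) (v : α → M) :
    (univ : Set M).Definable₁ L {y | p v y} :=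
  definable_substitute (α := Fin 1) (p := fun x u => p u (x 0))
    (hp.preimage_comp (fun o : Option α => o.elim (Sum.inl 0) Sum.inr)) v

theorem definable_snoc {k : ℕ} {Z : Set (Fin (k + 1) → M)} (hZ : A.Definable L Z) (e : Fin k → α)
    (i : α) :
    A.Definable L {v : α → M | (Fin.snoc (fun j => v (e j)) (v i) : Fin (k + 1) → M) ∈ Z} := by
  convert hZ.preimage_comp (Fin.snoc (α := fun _ => α) e i) using 1
  ext v
  rw [mem_preimage, Fin.comp_snoc]
  rfl

end Definability

/-! ### Unary definable sets -/

section Unary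

theorem IsPointOrOpenInterval.ordConnected {M : Type w} [LinearOrder M] {I : Set M}
    (hI : IsPointOrOpenInterval I) :
    I.OrdConnected := by
  rcases hI with ⟨a, rfl⟩ | ⟨a, b, rfl⟩ | ⟨a, rfl⟩ | ⟨a, rfl⟩ | rfl
  exacts [ordConnected_singleton, ordConnected_Ioo, ordConnected_Iio, ordConnected_Ioi,
    ordConnected_univ]

variable {L : FirstOrder.Language.{u, v}} {M : Type w} [AddCommGroup M] [LinearOrder M]
  [L.Structure M] {one : M} {A : Set M} {α : Type}

namespace IsOMinimalExpansion

theorem definable_lt (hM : IsOMinimalExpansion L one) (i j : α) :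
    A.Definable L {v : α → M | v i < v j} :=
  (hM.lt_definable.mono (empty_subset A)).preimage_comp ![i, j]

theorem definable_add_eq (hM : IsOMinimalExpansion L one) (i j k : α) :
    A.Definable L {v : α → M | v i + v j = v k} :=
  (hM.add_definable.mono (empty_subset A)).preimage_comp ![i, j, k]

theorem definable_lt_const (hM : IsOMinimalExpansion L one) (i : α) (a : M) :
    (univ : Set M).Definable L {v : α → M | v i < a} := by
  convert definable_exists (L := L) (p := fun (v : α → M) y => y = a ∧ v i < y)
    (definable_and (definable_eq_const (mem_univ _) _) (hM.definable_lt _ _)) using 1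
  ext v; simp

theorem definable_const_lt (hM : IsOMinimalExpansion L one) (i : α) (a : M) :
    (univ : Set M).Definable L {v : α → M | a < v i} := by
  convert definable_exists (L := L) (p := fun (v : α → M) y => y = a ∧ y < v i)
    (definable_and (definable_eq_const (mem_univ _) _) (hM.definable_lt _ _)) using 1
  ext v; simp

theorem definable_lt_add (hM : IsOMinimalExpansion L one) (i j k : α) :
    A.Definable L {v : α → M | v i < v j + v k} := by
  convert definable_exists (L := L) (A := A) (p := fun (v : α → M) y => v j + v k = y ∧ v i < y)
    (definable_and (hM.definable_add_eq _ _ _) (hM.definable_lt _ _)) using 1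
  ext v; simp

theorem definable_lt_add_const (hM : IsOMinimalExpansion L one) (i j : α) (c : M) :
    (univ : Set M).Definable L {v : α → M | v i < v j + c} := by
  convert definable_exists (L := L) (p := fun (v : α → M) y => y = c ∧ v i < v j + y)
    (definable_and (definable_eq_const (mem_univ _) _) (hM.definable_lt_add _ _ _)) using 1
  ext v; simp

theorem exists_Ioo_subset (hM : IsOMinimalExpansion L one) {X : Set M}
    (hX : (univ : Set M).Definable₁ L X) (hinf : X.Infinite) : ∃ a b, a < b ∧ Ioo a b ⊆ X := by
  obtain ⟨F, hF, hI, rfl⟩ := hM.finite_union X hX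
  have : ∃ I ∈ F, I.Infinite := by
    by_contra! h
    exact hinf (hF.sUnion fun I hI => h I hI)
  obtain ⟨I, hIF, hIinf⟩ := this
  obtain ⟨a, ha, b, hb, hab⟩ := hIinf.nontrivial.exists_lt
  exact ⟨a, b, hab, (Ioo_subset_Icc_self.trans ((hI I hIF).ordConnected.out ha hb)).trans
    (subset_sUnion_of_mem hIF)⟩

theorem infinite_iff [DenselyOrdered M] (hM : IsOMinimalExpansion L one) {X : Set M}
    (hX : (univ : Set M).Definable₁ L X) : X.Infinite ↔ ∃ a b, a < b ∧ Ioo a b ⊆ X :=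
  ⟨hM.exists_Ioo_subset hX, fun ⟨_, _, hab, h⟩ => (Ioo_infinite hab).mono h⟩

/-- The quantifier "there are infinitely many" preserves definability. -/
theorem definable_infinite [DenselyOrdered M] [Finite α] (hM : IsOMinimalExpansion L one)
    {p : (α → M) → M → Prop}
    (hp : A.Definable L {v : Option α → M | p (fun i => v (some i)) (v none)}) :
    A.Definable L {v : α → M | {y | p v y}.Infinite} := by
  have h : A.Definable L {v : α → M | ∃ a b, a < b ∧ ∀ y, a < y → y < b → p v y} :=
    definable_exists <| definable_exists <| definable_and (hM.definable_lt _ _) <|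
      definable_forall <| definable_imp (hM.definable_lt _ _) <|
        definable_imp (hM.definable_lt _ _) <|
          hp.preimage_comp (fun o : Option α => o.elim none fun i => some (some (some i)))
  convert h using 1
  ext v
  refine (hM.infinite_iff (definable_fibre hp v)).trans ?_
  exact exists_congr fun a => exists_congr fun b => and_congr_right fun _ =>
    ⟨fun h y h1 h2 => h ⟨h1, h2⟩, fun h y hy => h y hy.1 hy.2⟩

/-- A definable set accumulating at `y` from the left contains an interval with right endpoint
`y`. -/
theorem exists_Ioo_left_subset (hM : IsOMinimalExpansion L one) {X : Set M}
    (hX : (univ : Set M).Definable₁ L X) {p y : M} (hpy : p < y)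
    (hacc : ∀ ε, p ≤ ε → ε < y → (X ∩ Ioo ε y).Nonempty) : ∃ s, p ≤ s ∧ s < y ∧ Ioo s y ⊆ X := by
  obtain ⟨F, hF, hI, rfl⟩ := hM.finite_union X hX
  have : ∃ I ∈ F, ∀ ε, p ≤ ε → ε < y → (I ∩ Ioo ε y).Nonempty := by
    by_contra! h
    choose! e he1 he2 he3 using h
    obtain ⟨I₀, hI₀, -⟩ := hacc p le_rfl hpy
    obtain ⟨I₁, hI₁, -⟩ := hI₀
    obtain ⟨J, hJ, hmax⟩ := hF.exists_maximalFor e F ⟨I₁, hI₁⟩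
    obtain ⟨z, ⟨I, hIF, hzI⟩, hz⟩ := hacc (e J) (he1 J hJ) (he2 J hJ)
    have hle : e I ≤ e J := by
      rcases le_total (e I) (e J) with h | h
      exacts [h, hmax hIF h]
    exact (he3 I hIF).subset ⟨hzI, hle.trans_lt hz.1, hz.2⟩
  obtain ⟨I, hIF, hI'⟩ := this
  obtain ⟨s, hsI, hs1, hs2⟩ := hI' p le_rfl hpy
  refine ⟨s, hs1.le, hs2, fun z hz => ⟨I, hIF, ?_⟩⟩
  obtain ⟨t, htI, ht1, -⟩ := hI' z (hs1.le.trans hz.1.le) hz.2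
  exact (hI I hIF).ordConnected.out hsI htI ⟨hz.1.le, ht1.le⟩

theorem exists_isGLB [DenselyOrdered M] [NoMinOrder M] [NoMaxOrder M]
    (hM : IsOMinimalExpansion L one) {X : Set M}
    (hX : (univ : Set M).Definable₁ L X) (hne : X.Nonempty) (hbdd : BddBelow X) :
    ∃ x, IsGLB X x := by
  obtain ⟨F, hF, hI, rfl⟩ := hM.finite_union X hX
  clear hX
  induction F, hF using Set.Finite.induction_on with
  | empty => simp at hne
  | @insert I F _ _ ih =>
    rw [sUnion_insert] at hne hbdd ⊢
    have hbI : BddBelow I := hbdd.mono subset_union_left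
    rcases I.eq_empty_or_nonempty with rfl | hIne
    · simpa using ih (fun J hJ => hI J (mem_insert_of_mem _ hJ)) (by simpa using hne)
        (by simpa using hbdd)
    have hglbI : ∃ x, IsGLB I x := by
      rcases hI I (mem_insert _ _) with ⟨a, rfl⟩ | ⟨a, b, rfl⟩ | ⟨a, rfl⟩ | ⟨a, rfl⟩ | rfl
      · exact ⟨a, isGLB_singleton⟩
      · exact ⟨a, isGLB_Ioo (nonempty_Ioo.1 hIne)⟩
      · exact absurd hbI (not_bddBelow_Iio a)
      · exact ⟨a, isGLB_Ioi⟩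
      · exact absurd hbI not_bddBelow_univ
    obtain ⟨x, hx⟩ := hglbI
    rcases (⋃₀ F).eq_empty_or_nonempty with h0 | hFne
    · exact ⟨x, by simpa [h0] using hx⟩
    obtain ⟨x', hx'⟩ := ih (fun J hJ => hI J (mem_insert_of_mem _ hJ)) hFne
      (hbdd.mono subset_union_right)
    exact ⟨_, hx.union hx'⟩

/-- The order of an o-minimal ordered group is dense: if `e` were the least positive element, the
multiples of `e` would alternate between the definable subgroup of even elements and its
complement. -/
theorem denselyOrdered [IsOrderedAddMonoid M] (hM : IsOMinimalExpansion L one) :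
    DenselyOrdered M := by
  refine ⟨fun a b hab => ?_⟩
  by_contra! h
  set e := b - a with he
  have hepos : 0 < e := sub_pos.2 hab
  have hemin : ∀ x, 0 < x → e ≤ x := fun x hx => by
    by_contra! hxe
    have := h (a + x) (by simpa using hx)
    exact absurd this (not_le.2 (by rw [he] at hxe; exact lt_sub_iff_add_lt'.1 hxe))
  have hX : (univ : Set M).Definable₁ L {x | ∃ y, y + y = x} :=
    definable_exists (L := L) (p := fun (v : Fin 1 → M) y => y + y = v 0)
      (hM.definable_add_eq _ _ _)
  obtain ⟨F, hF, hI, hXF⟩ := hM.finite_union _ hX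
  have hev : ∀ n : ℕ, (2 * n) • e ∈ ⋃₀ F := fun n => by
    rw [← hXF]; exact ⟨n • e, by rw [← add_nsmul]; congr 1; omega⟩
  choose I hIF hmem using hev
  have hmono : StrictMono fun n : ℕ => n • e := nsmul_left_strictMono hepos
  obtain ⟨m, n, hmn, heq⟩ : ∃ m n, m < n ∧ I m = I n := by
    have := hF.to_subtype
    obtain ⟨m, n, hne, h⟩ := Finite.exists_ne_map_eq_of_infinite fun n => (⟨I n, hIF n⟩ : F)
    rw [Subtype.mk.injEq] at h
    rcases lt_or_gt_of_ne hne with hlt | hlt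
    exacts [⟨m, n, hlt, h⟩, ⟨n, m, hlt, h.symm⟩]
  have hodd : (2 * m + 1) • e ∈ {x : M | ∃ y, y + y = x} := by
    rw [hXF]
    exact ⟨I m, hIF m, (hI _ (hIF m)).ordConnected.out (hmem m) (heq ▸ hmem n)
      ⟨(hmono (by omega)).le, hmono.monotone (by omega)⟩⟩
  obtain ⟨y, hy⟩ := hodd
  have h1 : m • e < y := by
    by_contra! hle
    have h2 := add_le_add hle hle
    rw [hy, ← add_nsmul] at h2
    exact absurd (hmono.le_iff_le.1 h2) (by omega)
  have h3 := hemin (y - m • e) (sub_pos.2 h1)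
  have h4 : (m + 1) • e ≤ y := by rw [succ_nsmul]; exact le_sub_iff_add_le'.1 h3
  have h5 := add_le_add h4 h4
  rw [hy, ← add_nsmul] at h5
  exact absurd (hmono.le_iff_le.1 h5) (by omega)

end IsOMinimalExpansion

end Unary

/-! ### Interchanging the quantifier "there are infinitely many" -/

section Interchange

variable {L : FirstOrder.Language.{u, v}} {M : Type w} [AddCommGroup M] [LinearOrder M]
  [L.Structure M] {one : M} {A : Set M} {α : Type}

namespace IsOMinimalExpansion

/-- An infinite definable set is not covered by a definable chain of sets that meet it in finite
sets. -/
theorem exists_infinite_of_chain [DenselyOrdered M] (hM : IsOMinimalExpansion L one) {T : Set M}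
    (hT : (univ : Set M).Definable₁ L T) (hTinf : T.Infinite) {G : M → M → Prop}
    (hG : (univ : Set M).Definable L {v : Fin 2 → M | G (v 0) (v 1)})
    (hchain : ∀ c c', (∀ t, G c t → G c' t) ∨ (∀ t, G c' t → G c t))
    (hcover : ∀ t ∈ T, ∃ c, G c t) : ∃ c, {t | t ∈ T ∧ G c t}.Infinite := by
  by_contra! hfin
  obtain ⟨p, q, hpq, hpqT⟩ := hM.exists_Ioo_subset hT hTinf
  obtain ⟨y, hpy, hyq⟩ := exists_between hpq
  -- The chain induces a total preorder on `T`, in which `t` is below `t'` when every member of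
  -- the chain containing `t` contains `t'`; only finitely many elements lie above a given one.
  have hup : ∀ t ∈ T, {t' | t' ∈ T ∧ ∀ c, G c t → G c t'}.Finite := fun t ht => by
    obtain ⟨c, hc⟩ := hcover t ht
    exact (hfin c).subset fun t' h => ⟨h.1, h.2 c hc⟩
  -- The points of `(p, y)` that are strictly above everything between them and `y`.
  let R : Set M := {x | p < x ∧ x < y ∧ ∀ z, x < z → z < y → ∃ c, G c x ∧ ¬ G c z}
  have hR : (univ : Set M).Definable₁ L R := by
    have hG' : ∀ {α : Type} (i j : α), (univ : Set M).Definable L {v : α → M | G (v i) (v j)} :=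
      fun i j => hG.preimage_comp ![i, j]
    exact definable_and (hM.definable_const_lt _ _) <| definable_and (hM.definable_lt_const _ _) <|
      definable_forall <| definable_imp (hM.definable_lt _ _) <|
        definable_imp (hM.definable_lt_const _ _) <| definable_exists <|
          definable_and (hG' _ _) (definable_not (hG' _ _))
  have hacc : ∀ ε, p ≤ ε → ε < y → (R ∩ Ioo ε y).Nonempty := fun ε hpε hεy => by
    obtain ⟨x₁, hx₁, hx₁y⟩ := exists_between hεy
    have hT1 : ∀ {x}, ε < x → x < y → x ∈ T := fun h1 h2 =>
      hpqT ⟨hpε.trans_lt h1, h2.trans hyq⟩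
    obtain ⟨r, hr, hmax⟩ := Set.exists_max_image
      ({t' | t' ∈ T ∧ ∀ c, G c x₁ → G c t'} ∩ Ioo ε y) id
      ((hup x₁ (hT1 hx₁ hx₁y)).inter_of_left _) ⟨x₁, ⟨hT1 hx₁ hx₁y, fun _ => id⟩, hx₁, hx₁y⟩
    refine ⟨r, ⟨hpε.trans_lt hr.2.1, hr.2.2, fun z hrz hzy => ?_⟩, hr.2⟩
    by_contra! h
    have hεz := hr.2.1.trans hrz
    exact absurd (hmax z ⟨⟨hT1 hεz hzy, fun c hc => h c (hr.1.2 c hc)⟩, hεz, hzy⟩)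
      (not_le.2 hrz)
  obtain ⟨s, hps, hsy, hsR⟩ := hM.exists_Ioo_left_subset hR hpy hacc
  obtain ⟨x, hsx, hxy⟩ := exists_between hsy
  have hxT : x ∈ T := hpqT ⟨hps.trans_lt hsx, hxy.trans hyq⟩
  refine ((Ioo_infinite hsx).mono fun x' hx' => ?_) (hup x hxT)
  refine ⟨hpqT ⟨hps.trans_lt hx'.1, hx'.2.trans (hxy.trans hyq)⟩, fun c' hc' => ?_⟩
  obtain ⟨c, hc, hcx⟩ := (hsR ⟨hx'.1, hx'.2.trans hxy⟩).2.2 x hx'.2 hxy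
  rcases hchain c c' with h | h
  · exact h _ hc
  · exact absurd (h _ hc') hcx

/-- A definable family of infinite subsets of `M` over an infinite index set covers some point
infinitely often. Otherwise three applications of `exists_infinite_of_chain` produce infinitely many
members containing intervals of the same length with left endpoints in a bounded set, and these left
endpoints accumulate at a point, near which infinitely many of the intervals overlap. -/
theorem finite_setOf_infinite [IsOrderedAddMonoid M] (hM : IsOMinimalExpansion L one)
    {S : M → M → Prop} (hS : (univ : Set M).Definable L {v : Fin 2 → M | S (v 0) (v 1)})
    (hfin : ∀ d, {t | S t d}.Finite) : {t | {d | S t d}.Infinite}.Finite := by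
  by_contra hT
  have := hM.denselyOrdered
  have : Nontrivial M := ⟨⟨0, one, hM.one_pos.ne⟩⟩
  have hS' : ∀ {α : Type} (i j : α), (univ : Set M).Definable L {v : α → M | S (v i) (v j)} :=
    fun i j => hS.preimage_comp ![i, j]
  have hTdef : (univ : Set M).Definable₁ L {t | {d | S t d}.Infinite} :=
    hM.definable_infinite (p := fun (v : Fin 1 → M) d => S (v 0) d) (hS' _ _)
  -- A common length `c`.
  obtain ⟨c, hc⟩ := hM.exists_infinite_of_chain hTdef hT
    (G := fun c t => 0 < c ∧ ∃ x, ∀ z, x < z → z < x + c → S t z)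
    (definable_and (hM.definable_const_lt _ _) <| definable_exists <| definable_forall <|
      definable_imp (hM.definable_lt _ _) <| definable_imp (hM.definable_lt_add _ _ _) (hS' _ _))
    (fun c c' => by
      have key : ∀ {c c' : M}, 0 < c → c ≤ c' → ∀ t,
          (0 < c' ∧ ∃ x, ∀ z, x < z → z < x + c' → S t z) →
          (0 < c ∧ ∃ x, ∀ z, x < z → z < x + c → S t z) := fun hc hle t ⟨_, x, hx⟩ =>
        ⟨hc, x, fun z h1 h2 => hx z h1 (h2.trans_le (by gcongr))⟩
      rcases le_or_gt c 0 with h0 | h0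
      · exact .inl fun t h => absurd h.1 h0.not_gt
      rcases le_or_gt c' 0 with h0' | h0'
      · exact .inr fun t h => absurd h.1 h0'.not_gt
      rcases le_total c c' with h | h
      exacts [.inr (key h0 h), .inl (key h0' h)])
    (fun t ht => by
      obtain ⟨a, b, hab, hsub⟩ := hM.exists_Ioo_subset
        (definable_fibre (p := fun (v : Fin 1 → M) d => S (v 0) d) (hS' _ _) (fun _ => t)) ht
      exact ⟨b - a, sub_pos.2 hab, a, fun z h1 h2 => hsub ⟨h1, by simpa using h2⟩⟩)
  obtain ⟨-, -, hcpos, -⟩ := hc.nonempty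
  let H : M → M → Prop := fun t x => ∀ z, x < z → z < x + c → S t z
  have hH : ∀ {α : Type} (i j : α), (univ : Set M).Definable L {v : α → M | H (v i) (v j)} :=
    fun i j => definable_forall <| definable_imp (hM.definable_lt _ _) <|
      definable_imp (hM.definable_lt_add_const _ _ _) (hS' _ _)
  -- A common upper bound `N` for the left endpoints.
  obtain ⟨N, hN⟩ := hM.exists_infinite_of_chain (T := {t | ∃ x, H t x})
    (definable_exists (p := fun (v : Fin 1 → M) x => H (v 0) x) (hH _ _))
    (hc.mono fun t ht => ht.2.2) (G := fun N t => ∃ x, x < N ∧ H t x)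
    (definable_exists <| definable_and (hM.definable_lt _ _) (hH _ _))
    (fun c c' => (le_total c c').imp
      (fun h t ⟨x, hx, hx'⟩ => ⟨x, hx.trans_le h, hx'⟩)
      (fun h t ⟨x, hx, hx'⟩ => ⟨x, hx.trans_le h, hx'⟩))
    (fun t ⟨x, hx⟩ => let ⟨N, hN⟩ := exists_gt x; ⟨N, x, hN, hx⟩)
  -- A common lower bound `K`.
  obtain ⟨K, hK⟩ := hM.exists_infinite_of_chain (T := {t | ∃ x, x < N ∧ H t x})
    (definable_exists (p := fun (v : Fin 1 → M) x => x < N ∧ H (v 0) x)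
      (definable_and (hM.definable_lt_const _ _) (hH _ _)))
    (hN.mono fun t ht => ht.2) (G := fun K t => ∃ x, K < x ∧ x < N ∧ H t x)
    (definable_exists <| definable_and (hM.definable_lt _ _) <|
      definable_and (hM.definable_lt_const _ _) (hH _ _))
    (fun c c' => (le_total c c').symm.imp
      (fun h t ⟨x, hx, hx'⟩ => ⟨x, h.trans_lt hx, hx'⟩)
      (fun h t ⟨x, hx, hx'⟩ => ⟨x, h.trans_lt hx, hx'⟩))
    (fun t ⟨x, hx⟩ => let ⟨K, hK⟩ := exists_lt x; ⟨K, x, hK, hx⟩)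
  let V : Set M := {d | {t | ∃ x, K < x ∧ x < d ∧ H t x}.Infinite}
  have hV : (univ : Set M).Definable₁ L V :=
    hM.definable_infinite (p := fun (v : Fin 1 → M) t => ∃ x, K < x ∧ x < v 0 ∧ H t x) <|
      definable_exists <| definable_and (hM.definable_const_lt _ _) <|
        definable_and (hM.definable_lt _ _) (hH _ _)
  obtain ⟨l, hl⟩ := hM.exists_isGLB hV ⟨N, hK.mono fun t ht => ht.2⟩
    ⟨K, fun d hd => by
      obtain ⟨t, x, h1, h2, -⟩ := hd.nonempty
      exact (h1.trans h2).le⟩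
  obtain ⟨e, he0, hec⟩ : ∃ e, 0 < e ∧ e + e < c := by
    obtain ⟨e₁, h1, h2⟩ := exists_between hcpos
    obtain ⟨e, h3, h4⟩ := exists_between (lt_min h1 (sub_pos.2 h2))
    exact ⟨e, h3, (add_lt_add (h4.trans_le (min_le_left _ _))
      (h4.trans_le (min_le_right _ _))).trans_eq (by abel)⟩
  have hbelow : {t | ∃ x, K < x ∧ x < l - e ∧ H t x}.Finite := by
    by_contra h
    exact absurd (hl.1 h) (not_le.2 (sub_lt_self l he0))
  have habove : {t | ∃ x, K < x ∧ x < l + e ∧ H t x}.Infinite := by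
    obtain ⟨d, hd, -, hde⟩ := hl.exists_between (lt_add_of_pos_right l he0)
    refine Set.Infinite.mono (fun t ht => ?_) hd
    obtain ⟨x, h1, h2, h3⟩ := ht
    exact ⟨x, h1, h2.trans hde, h3⟩
  refine ((habove.sdiff hbelow).mono fun t ht => ?_) (hfin (l + e))
  obtain ⟨⟨x, h1, h2, h3⟩, h4⟩ := ht
  refine h3 _ h2 ?_
  have h5 : l - e ≤ x := not_lt.1 fun h => h4 ⟨x, h1, h, h3⟩
  calc l + e = l - e + (e + e) := by abel
    _ < l - e + c := by gcongr
    _ ≤ x + c := by gcongr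

/-- Interchange of the two quantifiers: after removal of the points `d` that lie in infinitely many
members of the family, only finitely many members remain infinite. -/
theorem infinite_setOf_infinite_swap [IsOrderedAddMonoid M] (hM : IsOMinimalExpansion L one)
    {S : M → M → Prop} (hS : (univ : Set M).Definable L {v : Fin 2 → M | S (v 0) (v 1)})
    (hinf : {t | {d | S t d}.Infinite}.Infinite) : {d | {t | S t d}.Infinite}.Infinite := by
  intro hfin
  have := hM.denselyOrdered
  have hS' : ∀ {α : Type} (i j : α), (univ : Set M).Definable L {v : α → M | S (v i) (v j)} :=
    fun i j => hS.preimage_comp ![i, j]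
  refine hinf ((hM.finite_setOf_infinite (S := fun t d => S t d ∧ ¬ {t' | S t' d}.Infinite)
    (definable_and (hS' _ _) <| definable_not <|
      hM.definable_infinite (p := fun (v : Fin 2 → M) t => S t (v 1)) (hS' _ _))
    fun d => ?_).subset fun t ht => ?_)
  · by_cases h : {t' | S t' d}.Infinite
    · simp [h]
    · exact (not_infinite.1 h).subset fun t ht => ht.1
  · exact (Set.Infinite.sdiff ht hfin).mono fun d hd => hd

end IsOMinimalExpansion

end Interchange

/-! ### Big sets -/

section Big

variable {M : Type w}

/-- A subset `Z` of `M^k` is big if there are infinitely many `x₁` for which there are infinitely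
many `x₂`, …, for which there are infinitely many `x_k` with `(x₁, …, x_k) ∈ Z`. -/
def IsBig : (k : ℕ) → Set (Fin k → M) → Prop
  | 0, Z => Z.Nonempty
  | k + 1, Z => IsBig k {x | {s | (Fin.snoc x s : Fin (k + 1) → M) ∈ Z}.Infinite}

theorem IsBig.mono {k : ℕ} {Z Z' : Set (Fin k → M)} (hZ : IsBig k Z) (h : Z ⊆ Z') :
    IsBig k Z' := by
  induction k with
  | zero => exact Set.Nonempty.mono h hZ
  | succ k ih => exact ih hZ fun x hx => Set.Infinite.mono (fun s hs => h hs) hx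

theorem IsBig.nonempty {k : ℕ} {Z : Set (Fin k → M)} (hZ : IsBig k Z) : Z.Nonempty := by
  induction k with
  | zero => exact hZ
  | succ k ih =>
    obtain ⟨x, hx⟩ := ih hZ
    obtain ⟨s, hs⟩ := hx.nonempty
    exact ⟨_, hs⟩

theorem IsBig.of_union {k : ℕ} {Z Z' : Set (Fin k → M)} (h : IsBig k (Z ∪ Z')) :
    IsBig k Z ∨ IsBig k Z' := by
  induction k with
  | zero => exact union_nonempty.1 h
  | succ k ih => exact ih (IsBig.mono h fun x hx => infinite_union.1 hx)

theorem IsBig.of_iUnion {k l : ℕ} {Z : Fin l → Set (Fin k → M)} (h : IsBig k (⋃ i, Z i)) :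
    ∃ i, IsBig k (Z i) := by
  induction l with
  | zero => simpa using h.nonempty
  | succ l ih =>
    have h' : IsBig k ((⋃ i : Fin l, Z i.castSucc) ∪ Z (Fin.last l)) := h.mono fun x hx => by
      obtain ⟨i, hi⟩ := mem_iUnion.1 hx
      induction i using Fin.lastCases with
      | last => exact .inr hi
      | cast i => exact .inl (mem_iUnion.2 ⟨i, hi⟩)
    rcases h'.of_union with h | h
    exacts [let ⟨i, hi⟩ := ih h; ⟨_, hi⟩, ⟨_, h⟩]

variable {L : FirstOrder.Language.{u, v}} [AddCommGroup M] [LinearOrder M] [L.Structure M] {one : M}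
  {A : Set M} {α : Type}

namespace IsOMinimalExpansion

/-- Bigness is definable in definable families. -/
theorem definable_isBig [DenselyOrdered M] [Finite α] (hM : IsOMinimalExpansion L one) {k : ℕ}
    {p : (α → M) → (Fin k → M) → Prop}
    (hp : A.Definable L {v : α ⊕ Fin k → M | p (fun i => v (.inl i)) (fun i => v (.inr i))}) :
    A.Definable L {v : α → M | IsBig k {x | p v x}} := by
  induction k with
  | zero => exact definable_exists_tuple hp
  | succ k ih =>
    refine ih (p := fun v x => {s | p v (Fin.snoc x s)}.Infinite) (hM.definable_infinite ?_)
    convert hp.preimage_comp (Sum.elim (fun i => some (.inl i))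
      (Fin.snoc (fun i => some (.inr i)) none) : α ⊕ Fin (k + 1) → Option (α ⊕ Fin k)) using 1
    ext v
    simp only [mem_ofPred_eq, mem_preimage, Function.comp_apply, Sum.elim_inl, Sum.elim_inr]
    rw [← Function.comp_def v (Fin.snoc _ _), Fin.comp_snoc]
    rfl

theorem infinite_setOf_isBig [IsOrderedAddMonoid M] (hM : IsOMinimalExpansion L one) {k : ℕ}
    {R : (Fin k → M) → M → Prop} (hR : (univ : Set M).Definable L
      {v : Option (Fin k) → M | R (fun i => v (some i)) (v none)})
    (h : IsBig k {x | {s | R x s}.Infinite}) : {s | IsBig k {x | R x s}}.Infinite := by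
  have := hM.denselyOrdered
  induction k with
  | zero =>
    obtain ⟨x, hx⟩ := h
    exact Set.Infinite.mono (fun s hs => ⟨x, hs⟩) hx
  | succ k ih =>
    have hR' : ∀ {β : Type} (e : Fin k → β) (i j : β), (univ : Set M).Definable L
        {v : β → M | R (Fin.snoc (fun i => v (e i)) (v i)) (v j)} := fun {β} e i j => by
      convert hR.preimage_comp (fun o : Option (Fin (k + 1)) =>
        o.elim j (Fin.snoc (α := fun _ => β) e i)) using 1
      ext v
      simp only [mem_ofPred_eq, mem_preimage, Function.comp_apply, Option.elim]
      rw [← Function.comp_def v (Fin.snoc _ _), Fin.comp_snoc]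
      rfl
    refine ih (R := fun x s => {t | R (Fin.snoc x t) s}.Infinite)
      (hM.definable_infinite (hR' _ _ _)) (IsBig.mono h fun x hx => ?_)
    exact hM.infinite_setOf_infinite_swap (definable_substitute
      (p := fun (v : Fin 2 → M) x => R (Fin.snoc x (v 0)) (v 1)) (hR' _ _ _) x) hx

/-- A big definable set has nonempty interior: infinitely many fibres over the last coordinate
contain intervals, and interchanging quantifiers makes a single interval serve a big set of
fibres. -/
theorem interior_nonempty_of_isBig [IsOrderedAddMonoid M] [TopologicalSpace M] [OrderTopology M]
    (hM : IsOMinimalExpansion L one) {k : ℕ} {Z : Set (Fin k → M)}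
    (hZ : (univ : Set M).Definable L Z) (h : IsBig k Z) : (interior Z).Nonempty := by
  have := hM.denselyOrdered
  have : Nontrivial M := ⟨⟨0, one, hM.one_pos.ne⟩⟩
  induction k with
  | zero =>
    obtain ⟨x, hx⟩ := h
    rw [show Z = univ from eq_univ_of_forall fun y => Subsingleton.elim x y ▸ hx, interior_univ]
    exact ⟨x, trivial⟩
  | succ k ih =>
    let J : (Fin k → M) → M → M → Prop := fun x a b =>
      a < b ∧ ∀ y, a < y → y < b → (Fin.snoc x y : Fin (k + 1) → M) ∈ Z
    have hJ : ∀ {β : Type} (e : Fin k → β) (i j : β), (univ : Set M).Definable L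
        {v : β → M | J (fun i => v (e i)) (v i) (v j)} := fun {β} e i j => by
      refine definable_and (hM.definable_lt _ _) <| definable_forall <|
        definable_imp (hM.definable_lt _ _) <| definable_imp (hM.definable_lt _ _) <|
          definable_snoc hZ _ _
    have hbig : IsBig k {x | {a | {b | J x a b}.Infinite}.Infinite} := IsBig.mono h fun x hx => by
      obtain ⟨a, b, hab, hsub⟩ := hM.exists_Ioo_subset
        (definable_fibre (p := fun x s => (Fin.snoc x s : Fin (k + 1) → M) ∈ Z)
          (definable_snoc hZ _ _) x) hx
      refine (Ioo_infinite hab).mono fun a' ha' => ?_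
      exact (Ioo_infinite ha'.2).mono fun b' hb' =>
        ⟨hb'.1, fun y h1 h2 => hsub ⟨ha'.1.trans h1, h2.trans hb'.2⟩⟩
    obtain ⟨a, ha⟩ := (hM.infinite_setOf_isBig (hM.definable_infinite (hJ _ _ _)) hbig).nonempty
    obtain ⟨b, hb⟩ := (hM.infinite_setOf_isBig (R := fun x b => J x a b)
      (definable_substitute (p := fun (v : Option (Fin k) → M) (u : Unit → M) =>
        J (fun i => v (some i)) (u ()) (v none)) (hJ _ _ _) fun _ => a) ha).nonempty
    obtain ⟨x, hx⟩ := ih (definable_substitute (p := fun x (u : Fin 2 → M) => J x (u 0) (u 1))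
      (hJ _ _ _) ![a, b]) hb
    obtain ⟨x', hab, -⟩ := hb.nonempty
    obtain ⟨y, hay, hyb⟩ := exists_between hab
    have hopen : IsOpen {v : Fin (k + 1) → M | Fin.init v ∈ interior {x | J x a b} ∧
        v (Fin.last k) ∈ Ioo a b} :=
      (isOpen_interior.preimage (continuous_pi fun i => continuous_apply i.castSucc)).inter
        (isOpen_Ioo.preimage (continuous_apply _))
    refine ⟨Fin.snoc x y, interior_maximal (fun v hv => ?_) hopen ⟨?_, ?_⟩⟩
    · have := (interior_subset hv.1).2 _ hv.2.1 hv.2.2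
      rwa [Fin.snoc_init_self] at this
    · simpa using hx
    · simpa using ⟨hay, hyb⟩

end IsOMinimalExpansion

end Big

/-! ### Eliminating parameters that depend on the others -/

section Dependence

variable {L : FirstOrder.Language.{u, v}} {M : Type w} [AddCommGroup M] [LinearOrder M]
  [L.Structure M] {one : M} {A : Set M}

namespace IsOMinimalExpansion

/-- If the line through `b ∈ B` in direction `j` meets `B` in a finite set, then `b` lies in a
subset of `B`, definable over the same parameters, in which the coordinate `j` is a function of the
others: it consists of the points of `B` that have as many points of `B` below them, on their line
in direction `j`, as `b` has. -/
theorem exists_functional_of_finite (hM : IsOMinimalExpansion L one) {k : ℕ} (j : Fin k)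
    {b : Fin k → M} {B : Set (Fin k → M)} (hB : A.Definable L B) (hb : b ∈ B)
    (hfin : {s | Function.update b j s ∈ B}.Finite) :
    ∃ R : Set (Fin k → M), A.Definable L R ∧ b ∈ R ∧
      ∀ v ∈ R, ∀ w ∈ R, (∀ i, i ≠ j → v i = w i) → v = w := by
  have hupd : ∀ {B : Set (Fin k → M)}, A.Definable L B →
      A.Definable L {v : Option (Fin k) → M |
        v none < v (some j) ∧ Function.update (fun i => v (some i)) j (v none) ∈ B} := by
    intro B hB
    refine definable_and (hM.definable_lt _ _) ?_
    convert hB.preimage_comp (Function.update some j none) using 1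
    ext v
    rw [mem_preimage, Function.comp_update]
    rfl
  generalize hn : {s | s < b j ∧ Function.update b j s ∈ B}.ncard = n
  induction n generalizing B with
  | zero =>
    have hempty := (ncard_eq_zero (hfin.subset fun s hs => hs.2)).1 hn
    refine ⟨{v | v ∈ B ∧ ¬ ∃ s, s < v j ∧ Function.update v j s ∈ B},
      definable_and hB (definable_not (definable_exists (hupd hB))),
      ⟨hb, fun ⟨s, hs⟩ => hempty.subset hs⟩, fun v hv w hw hvw => ?_⟩
    have hvw' : Function.update v j (w j) = w := by
      ext i; by_cases h : i = j
      · subst h; simp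
      · simp [h, hvw i h]
    have hwv' : Function.update w j (v j) = v := by
      ext i; by_cases h : i = j
      · subst h; simp
      · simp [h, hvw i h]
    rcases lt_trichotomy (v j) (w j) with h | h | h
    · exact absurd ⟨v j, h, hwv'.symm ▸ hv.1⟩ hw.2
    · rw [← hvw', ← h, Function.update_eq_self]
    · exact absurd ⟨w j, h, hvw'.symm ▸ hw.1⟩ hv.2
  | succ n ih =>
    -- Removing the least point of every line lowers the number of points below `b` by one.
    have hfin' : {s | s < b j ∧ Function.update b j s ∈ B}.Finite := hfin.subset fun s hs => hs.2
    have hne : {s | s < b j ∧ Function.update b j s ∈ B}.Nonempty :=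
      nonempty_of_ncard_ne_zero (by omega)
    refine ih (B := {v | v ∈ B ∧ ∃ s, s < v j ∧ Function.update v j s ∈ B})
      (definable_and hB (definable_exists (hupd hB))) ⟨hb, hne⟩
      (hfin.subset fun s hs => hs.1) ?_
    obtain ⟨m, hm, hmin⟩ := exists_min_image _ id hfin' hne
    have : {s | s < b j ∧ Function.update b j s ∈
        {v | v ∈ B ∧ ∃ s, s < v j ∧ Function.update v j s ∈ B}} =
        {s | s < b j ∧ Function.update b j s ∈ B} \ {m} := by
      ext s
      simp only [mem_ofPred_eq, mem_sdiff, mem_singleton_iff, Function.update_self,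
        Function.update_idem]
      constructor
      · rintro ⟨h1, h2, t, h3, h4⟩
        refine ⟨⟨h1, h2⟩, ?_⟩
        rintro rfl
        exact absurd (hmin t ⟨h3.trans h1, h4⟩) (not_le.2 h3)
      · rintro ⟨⟨h1, h2⟩, h3⟩
        exact ⟨h1, h2, m, lt_of_le_of_ne (hmin s ⟨h1, h2⟩) (Ne.symm h3), hm.2⟩
    rw [this, ncard_sdiff_singleton_of_mem hm, hn, Nat.add_sub_cancel]

/-- If a definable set is not big, then going through the coordinates from the last to the first,
each of its points `b` meets a coordinate that takes only finitely many values given the preceding ones,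
and hence depends definably on the other coordinates. -/
theorem isBig_or_exists_functional [DenselyOrdered M] (hM : IsOMinimalExpansion L one) {k : ℕ}
    {F : Set (Fin k → M)} (hF : A.Definable L F) {b : Fin k → M} (hb : b ∈ F) :
    IsBig k F ∨ ∃ (j : Fin k) (R : Set (Fin k → M)), A.Definable L R ∧ b ∈ R ∧
      ∀ v ∈ R, ∀ w ∈ R, (∀ i, i ≠ j → v i = w i) → v = w := by
  induction k with
  | zero => exact .inl ⟨b, hb⟩
  | succ k ih =>
    by_cases h : {s | (Fin.snoc (Fin.init b) s : Fin (k + 1) → M) ∈ F}.Infinite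
    · refine (ih (hM.definable_infinite (p := fun x s => (Fin.snoc x s : Fin (k + 1) → M) ∈ F)
        (definable_snoc hF _ _)) h).imp id ?_
      rintro ⟨j, R, hR, hbR, hfun⟩
      refine ⟨j.castSucc, {v | Fin.init v ∈ R}, hR.preimage_comp Fin.castSucc, hbR,
        fun v hv w hw hvw => ?_⟩
      have := hfun _ hv _ hw fun i hi => hvw _ (by simpa using hi)
      rw [← Fin.snoc_init_self v, ← Fin.snoc_init_self w, this,
        hvw (Fin.last k) (Fin.castSucc_lt_last j).ne']
    · refine .inr ⟨Fin.last k, hM.exists_functional_of_finite _ hF hb ?_⟩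
      convert not_infinite.1 h using 4
      rw [← Fin.update_snoc_last (x := b (Fin.last k)), Fin.snoc_init_self]

end IsOMinimalExpansion

end Dependence

/-! ### Definability in the pair -/

section Pair

variable {L : FirstOrder.Language.{u, v}} {M : Type w} [L.Structure M] {P A D : Set M}

theorem Set.Definable.pairDefinable {n : ℕ} {X : Set (Fin n → M)} (hX : A.Definable L X) :
    PairDefinable L P A X := by
  let := unaryPredStructure P
  exact hX.map_expansion (L' := L.sum unaryPredLanguage) Language.LHom.sumInl

/-- A term of the language of the induced structure is a variable or a constant, and so its value
has a definable graph. -/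
theorem exists_definable_graph_of_term {β : Type}
    (t : ((inducedLanguage L D)[[((↑) ⁻¹' A : Set P)]]).Term β) :
    ∃ f : (β → M) → M, (∀ x : β → P, f (fun i => x i) = (t.realize x : P)) ∧
      ∀ (L' : FirstOrder.Language.{u, v}) [L'.Structure M] {γ : Type} (e : β → γ) (i : γ),
        A.Definable L' {v : γ → M | v i = f fun j => v (e j)} := by
  cases t with
  | var j => exact ⟨fun v => v j, fun x => rfl, fun L' _ γ e i => definable_eq _ _⟩
  | @func m g ts =>
    rcases g with g | g
    · exact g.elim
    · match m, g, ts with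
      | 0, g, ts => exact ⟨fun _ => (g : P), fun x => rfl,
          fun L' _ γ e i => definable_eq_const (a := ((g : P) : M)) g.2 _⟩
      | m + 1, g, ts => exact g.elim

/-- A definition in the induced structure becomes a definition in the pair by restricting all
variables to `P`. -/
theorem InducedDefinable.pairDefinable {n : ℕ} {X : Set (Fin n → M)}
    (hX : InducedDefinable L P D A X) : PairDefinable L P (A ∪ D) X := by
  let := unaryPredStructure P
  obtain ⟨hXP, φ, hφ⟩ := hX
  change (A ∪ D).Definable (L.sum unaryPredLanguage) X
  have hP : ∀ {γ : Type} (i : γ), (A ∪ D).Definable (L.sum unaryPredLanguage)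
      {v : γ → M | v i ∈ P} := fun {γ} i => by
    refine Set.Definable.mono (A := ∅) (empty_definable_iff.2
      ⟨Language.Relations.formula₁ (L := L.sum unaryPredLanguage) (Sum.inr UnaryPredRel.mem)
        (Language.Term.var i), ?_⟩) (empty_subset _)
    ext v
    simp
    rfl
  have key : ∀ {m : ℕ} (ψ : ((inducedLanguage L D)[[((↑) ⁻¹' A : Set P)]]).BoundedFormula
      (Fin n) m), (A ∪ D).Definable (L.sum unaryPredLanguage) {v : Fin n ⊕ Fin m → M |
        ∃ (x : Fin n → P) (z : Fin m → P), v = Sum.elim (fun i => (x i : M)) (fun i => (z i : M)) ∧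
          ψ.Realize x z} := by
    intro m ψ
    have hinj : ∀ {m : ℕ} {x x' : Fin n → P} {z z' : Fin m → P},
        Sum.elim (fun i => (x i : M)) (fun i => (z i : M)) =
          Sum.elim (fun i => (x' i : M)) (fun i => (z' i : M)) → x = x' ∧ z = z' := fun h =>
      ⟨funext fun i => Subtype.ext (congrFun h (.inl i)),
        funext fun i => Subtype.ext (congrFun h (.inr i))⟩
    have hsurj : ∀ {m : ℕ} {v : Fin n ⊕ Fin m → M}, (∀ i, v i ∈ P) →
        ∃ (x : Fin n → P) (z : Fin m → P),
          v = Sum.elim (fun i => (x i : M)) (fun i => (z i : M)) := fun hv =>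
      ⟨fun i => ⟨_, hv (.inl i)⟩, fun i => ⟨_, hv (.inr i)⟩, by ext (i | i) <;> rfl⟩
    have hmem : ∀ {m : ℕ} (x : Fin n → P) (z : Fin m → P) (i),
        Sum.elim (fun i => (x i : M)) (fun i => (z i : M)) i ∈ P := fun x z i => by
      rcases i with i | i
      exacts [(x i).2, (z i).2]
    have helim : ∀ {m : ℕ} (x : Fin n → P) (z : Fin m → P),
        (fun i => ((Sum.elim x z i : P) : M)) =
          Sum.elim (fun i => (x i : M)) (fun i => (z i : M)) := fun x z => by
      ext (i | i) <;> rfl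
    induction ψ with
    | falsum =>
      convert definable_empty using 1
      ext v
      simp [Language.BoundedFormula.Realize]
    | equal t₁ t₂ =>
      obtain ⟨f₁, hf₁, hd₁⟩ := exists_definable_graph_of_term t₁
      obtain ⟨f₂, hf₂, hd₂⟩ := exists_definable_graph_of_term t₂
      convert definable_and (definable_forall_index fun i => hP i)
        (definable_exists (p := fun v y => y = f₁ v ∧ y = f₂ v) (definable_and
          ((hd₁ (L.sum unaryPredLanguage) some none).mono subset_union_left)
          ((hd₂ (L.sum unaryPredLanguage) some none).mono subset_union_left))) using 1
      ext v
      simp only [mem_ofPred_eq, exists_eq_left, Language.BoundedFormula.Realize]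
      constructor
      · rintro ⟨x, z, rfl, h⟩
        exact ⟨hmem x z, by rw [← helim, hf₁, hf₂, h]⟩
      · rintro ⟨hv, h⟩
        obtain ⟨x, z, rfl⟩ := hsurj hv
        rw [← helim, hf₁, hf₂] at h
        exact ⟨x, z, rfl, Subtype.ext h⟩
    | @rel m l R ts =>
      rcases R with R | R
      · choose f hf hd using fun i => exists_definable_graph_of_term (ts i)
        have hR : (A ∪ D).Definable (L.sum unaryPredLanguage)
            {u : Fin l → M | Language.Formula.Realize (L := L[[D]]) R u} :=
          (Set.Definable.mono (A := D) ⟨R, rfl⟩ subset_union_right).map_expansion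
            (L' := L.sum unaryPredLanguage) Language.LHom.sumInl
        convert definable_and (definable_forall_index fun i => hP i)
          (definable_exists_tuple (p := fun v (u : Fin l → M) => (∀ i, u i = f i v) ∧
            Language.Formula.Realize (L := L[[D]]) R u) (definable_and
              (definable_forall_index fun i =>
                (hd i (L.sum unaryPredLanguage) Sum.inl (Sum.inr i)).mono subset_union_left)
              (hR.preimage_comp Sum.inr))) using 1
        ext v
        have hrel : ∀ (x : Fin n → P) (z : Fin m → P), (Language.BoundedFormula.rel
            (L := (inducedLanguage L D)[[((↑) ⁻¹' A : Set P)]]) (Sum.inl R) ts).Realize x z ↔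
            Language.Formula.Realize (L := L[[D]]) R
              (fun i => f i (Sum.elim (fun i => (x i : M)) (fun i => (z i : M)))) := fun x z => by
          rw [← helim]
          simp only [hf]
          rfl
        simp only [mem_ofPred_eq, ← funext_iff (g := fun i => f i v), exists_eq_left]
        constructor
        · rintro ⟨x, z, rfl, h⟩
          exact ⟨hmem x z, (hrel x z).1 h⟩
        · rintro ⟨hv, h⟩
          obtain ⟨x, z, rfl⟩ := hsurj hv
          exact ⟨x, z, rfl, (hrel x z).2 h⟩
      · exact R.elim
    | imp ψ₁ ψ₂ ih₁ ih₂ =>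
      convert definable_and (definable_forall_index fun i => hP i) (definable_imp ih₁ ih₂) using 1
      ext v
      simp only [mem_ofPred_eq, Language.BoundedFormula.realize_imp]
      constructor
      · rintro ⟨x, z, rfl, h⟩
        refine ⟨hmem x z, ?_⟩
        rintro ⟨x', z', hv, h'⟩
        obtain ⟨rfl, rfl⟩ := hinj hv
        exact ⟨x, z, rfl, h h'⟩
      · rintro ⟨hv, h⟩
        obtain ⟨x, z, rfl⟩ := hsurj hv
        refine ⟨x, z, rfl, fun h' => ?_⟩
        obtain ⟨x', z', hv, h''⟩ := h ⟨x, z, rfl, h'⟩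
        obtain ⟨rfl, rfl⟩ := hinj hv
        exact h''
    | @all m ψ ih =>
      have hsnoc : ∀ (x : Fin n → P) (z : Fin m → P) (y : P),
          Sum.elim (fun i => (x i : M)) (fun i => ((Fin.snoc z y : Fin (m + 1) → P) i : M)) =
            Sum.elim (fun i => (x i : M)) (Fin.snoc (fun i => (z i : M)) (y : M)) :=
        fun x z y => by
          congr 1
          exact Fin.comp_snoc (Subtype.val : P → M) z y
      convert definable_and (definable_forall_index fun i => hP i)
        (definable_forall (p := fun (v : Fin n ⊕ Fin m → M) y =>
          y ∈ P → ∃ (x : Fin n → P) (z : Fin (m + 1) → P),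
          Sum.elim (fun i => v (.inl i)) (Fin.snoc (fun i => v (.inr i)) y) =
            Sum.elim (fun i => (x i : M)) (fun i => (z i : M)) ∧ ψ.Realize x z)
          (definable_imp (hP none) ?_)) using 1
      · ext v
        simp only [mem_ofPred_eq, Language.BoundedFormula.realize_all]
        constructor
        · rintro ⟨x, z, rfl, h⟩
          exact ⟨hmem x z, fun y hy => ⟨x, Fin.snoc z ⟨y, hy⟩, (hsnoc x z ⟨y, hy⟩).symm, h _⟩⟩
        · rintro ⟨hv, h⟩
          obtain ⟨x, z, rfl⟩ := hsurj hv
          refine ⟨x, z, rfl, fun y => ?_⟩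
          obtain ⟨x', z', hv, h'⟩ := h y y.2
          obtain ⟨rfl, rfl⟩ := hinj ((hsnoc x z y).trans hv)
          exact h'
      · convert ih.preimage_comp (Sum.elim (fun i => some (.inl i))
          (Fin.snoc (fun i => some (.inr i)) none) :
            Fin n ⊕ Fin (m + 1) → Option (Fin n ⊕ Fin m)) using 1
        ext v
        rw [mem_preimage, Sum.comp_elim, Fin.comp_snoc]
        rfl
  convert (key φ).preimage_comp (Sum.elim id Fin.elim0 : Fin n ⊕ Fin 0 → Fin n) using 1
  ext v
  have hφ' : ∀ x : Fin n → P, (fun i => (x i : M)) ∈ X ↔ φ.Realize x := fun x =>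
    Set.ext_iff.1 hφ x
  simp only [mem_preimage, mem_ofPred_eq]
  constructor
  · intro hv
    refine ⟨fun i => ⟨v i, hXP hv i⟩, Fin.elim0, ?_, ?_⟩
    · ext (i | i)
      exacts [rfl, i.elim0]
    · rw [Subsingleton.elim Fin.elim0 default]
      exact (hφ' fun i => ⟨v i, hXP hv i⟩).1 hv
  · rintro ⟨x, z, hv, h⟩
    have hv' : v = fun i => (x i : M) := funext fun i => congrFun hv (.inl i)
    rw [Subsingleton.elim z default] at h
    rw [hv']
    exact (hφ' x).2 h

end Pair

/-! ### Replacing arbitrary parameters -/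

section Parameters

variable {L : FirstOrder.Language.{u, v}} {M : Type w} [L.Structure M]

/-- Finitely many sets that are definable with parameters are members, at a common parameter tuple
`b`, of families that are definable without parameters. -/
theorem exists_families_of_definable {n l : ℕ} {Y : Fin l → Set (Fin n → M)}
    (hY : ∀ i, (univ : Set M).Definable L (Y i)) :
    ∃ (k : ℕ) (b : Fin k → M) (Z : Fin l → Set (Fin n ⊕ Fin k → M)),
      (∀ i, (∅ : Set M).Definable L (Z i)) ∧ ∀ i, Y i = {x | Sum.elim x b ∈ Z i} := by
  choose T _ hT using fun i => definable_iff_finitely_definable.1 (hY i)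
  obtain ⟨k, b, hb⟩ : ∃ (k : ℕ) (b : Fin k → M), range b = ⋃ i, (T i : Set M) := by
    have hfin : (⋃ i, (T i : Set M)).Finite := finite_iUnion fun i => (T i).finite_toSet
    have := hfin.to_subtype
    obtain ⟨k, ⟨e⟩⟩ := Finite.exists_equiv_fin (⋃ i, (T i : Set M) : Set M)
    exact ⟨k, fun i => e.symm i, by
      rw [← Function.comp_def Subtype.val, EquivLike.range_comp, Subtype.range_coe]⟩
  have hTb : ∀ i, (range b).Definable L (Y i) := fun i =>
    (hT i).mono (hb ▸ subset_iUnion (fun i => (T i : Set M)) i)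
  choose φ hφ using fun i => definable_iff_exists_formula_sum.1 (hTb i)
  choose g hg using fun t : range b => t.2
  refine ⟨k, b, fun i => {v | (φ i).Realize fun j => v (Sum.elim (fun t => .inr (g t)) .inl j)},
    fun i => (empty_definable_iff.2 ⟨φ i, rfl⟩).preimage_comp _, fun i => ?_⟩
  rw [hφ i]
  ext x
  simp only [mem_ofPred_eq]
  refine iff_of_eq (congrArg _ (funext fun j => ?_))
  rcases j with t | j
  exacts [(hg t).symm, rfl]

end Parameters

/-! ### Averaging over the closure of the set of parameters -/

section Main

variable {L : FirstOrder.Language.{u, v}} {M : Type w} [AddCommGroup M] [LinearOrder M]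
  [L.Structure M] {one : M} {P C : Set M}

/-- Let `C` be a parameter set such that closures of sets `C`-definable in the pair are
`C`-definable in `M`. If `X = ⋃ i, Y i ∩ Q i`, where `X` and the `Q i` are `C`-definable in the pair
and the `Y i` are members, at a parameter `b`, of families that are `C`-definable in `M`, then the
`Y i` can be replaced by sets that are `C`-definable in `M`. -/
theorem IsOMinimalExpansion.exists_definable_cover [IsOrderedAddMonoid M] [TopologicalSpace M]
    [OrderTopology M] (hM : IsOMinimalExpansion L one)
    (hC : ∀ (k : ℕ) (E : Set (Fin k → M)), PairDefinable L P C E → C.Definable L (closure E))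
    {n l : ℕ} {X : Set (Fin n → M)} {Q : Fin l → Set (Fin n → M)} (hX : PairDefinable L P C X)
    (hQ : ∀ i, PairDefinable L P C (Q i)) {k : ℕ} {Y : Fin l → Set (Fin n ⊕ Fin k → M)}
    (hY : ∀ i, C.Definable L (Y i)) {b : Fin k → M}
    (hb : X = ⋃ i, {x | Sum.elim x b ∈ Y i} ∩ Q i) :
    ∃ W : Fin l → Set (Fin n → M), (∀ i, C.Definable L (W i)) ∧ X = ⋃ i, W i ∩ Q i := by
  have := hM.denselyOrdered
  induction k using Nat.strong_induction_on with
  | _ k ih =>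
  -- The set of all parameters that define `X`.
  let E : Set (Fin k → M) := {b | ∀ x, x ∈ X ↔ ∃ i, Sum.elim x b ∈ Y i ∧ x ∈ Q i}
  have hbE : b ∈ E := fun x => by rw [hb]; simp
  have hE : PairDefinable L P C E := by
    let := unaryPredStructure P
    refine definable_forall_tuple (p := fun b x => x ∈ X ↔ ∃ i, Sum.elim x b ∈ Y i ∧ x ∈ Q i)
      (definable_iff (Set.Definable.preimage_comp Sum.inr hX) <| definable_exists_index fun i =>
        definable_and ?_ (Set.Definable.preimage_comp Sum.inr (hQ i)))
    convert ((hY i).map_expansion (L' := L.sum unaryPredLanguage)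
      Language.LHom.sumInl).preimage_comp Sum.swap using 1
    ext v
    refine iff_of_eq (congrArg (· ∈ Y i) (funext fun j => ?_))
    rcases j with j | j <;> rfl
  have hF := hC k E hE
  rcases hM.isBig_or_exists_functional hF (subset_closure hbE) with hbig | ⟨j, R, hR, hbR, hfun⟩
  · -- A big definable subset of `closure E` contains an open set and hence meets `E`; so for
    -- `x ∈ Q i` bigness of the set of parameters in `closure E` decides whether `x ∈ X`.
    have hmeet : ∀ Z : Set (Fin k → M), (univ : Set M).Definable L Z → IsBig k (closure E ∩ Z) →
        (E ∩ Z).Nonempty := fun Z hZ h => by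
      obtain ⟨c, hc⟩ := hM.interior_nonempty_of_isBig
        ((hF.mono (subset_univ _)).inter hZ) h
      obtain ⟨c', hc', hcE⟩ := mem_closure_iff.1 (interior_subset hc).1 _ isOpen_interior hc
      exact ⟨c', hcE, (interior_subset hc').2⟩
    have hYx : ∀ i x, (univ : Set M).Definable L {c : Fin k → M | Sum.elim x c ∈ Y i} := by
      intro i x
      refine definable_substitute (A := C) (p := fun (c : Fin k → M) x => Sum.elim x c ∈ Y i) ?_ x
      convert (hY i).preimage_comp Sum.swap using 1
      ext v
      refine iff_of_eq (congrArg (· ∈ Y i) (funext fun j => ?_))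
      rcases j with j | j <;> rfl
    refine ⟨fun i => {x | IsBig k (closure E ∩ {c | Sum.elim x c ∈ Y i})}, fun i => ?_, ?_⟩
    · refine hM.definable_isBig (p := fun x c => c ∈ closure E ∧ Sum.elim x c ∈ Y i)
        (definable_and (hF.preimage_comp Sum.inr) ?_)
      convert hY i using 1
      ext v
      exact iff_of_eq (congrArg (· ∈ Y i) (Sum.elim_comp_inl_inr v))
    ext x
    simp only [mem_iUnion, mem_inter_iff]
    constructor
    · intro hx
      -- The parts of `closure E` given by the `i` with `x ∈ Q i` cover `E`.
      let Z : Fin l → Set (Fin k → M) := fun i => {c | x ∈ Q i ∧ Sum.elim x c ∈ Y i}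
      have hZ : ∀ i, (univ : Set M).Definable L (Z i) := fun i => by
        by_cases hi : x ∈ Q i
        · simpa [Z, hi] using hYx i x
        · simp [Z, hi]
      have hsplit : IsBig k ((closure E ∩ (⋃ i, Z i)ᶜ) ∪ ⋃ i, closure E ∩ Z i) := by
        rw [← inter_iUnion, ← inter_union_distrib_left, compl_union_self, inter_univ]
        exact hbig
      rcases hsplit.of_union with h | h
      · obtain ⟨c, hcE, hc⟩ := hmeet _ (definable_iUnion_of_finite hZ).compl h
        obtain ⟨i, hi, hiQ⟩ := (hcE x).1 hx
        exact (hc (mem_iUnion.2 ⟨i, hiQ, hi⟩)).elim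
      · obtain ⟨i, hi⟩ := h.of_iUnion
        obtain ⟨c, -, hc⟩ := hi.nonempty
        exact ⟨i, hi.mono (inter_subset_inter_right _ fun c hc => hc.2), hc.1⟩
    · rintro ⟨i, hi, hiQ⟩
      obtain ⟨c, hcE, hc⟩ := hmeet _ (hYx i x) hi
      exact (hcE x).2 ⟨i, hc, hiQ⟩
  · -- The coordinate `j` of `b` is a function of the others, so the families can be reindexed by
    -- the remaining coordinates.
    cases k with
    | zero => exact j.elim0
    | succ k =>
    have hins : ∀ {α : Type} (f : α → M) (e : Fin k → α) (a : α),
        (j.insertNth (f a) fun i => f (e i) : Fin (k + 1) → M) =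
          fun i => f ((j.insertNth a e : Fin (k + 1) → α) i) := fun f e a => by
      ext i
      refine Fin.succAboveCases j ?_ (fun i => ?_) i <;> simp
    refine ih k k.lt_succ_self
      (Y := fun i => {v | ∃ s, (j.insertNth s fun i => v (.inr i) : Fin (k + 1) → M) ∈ R ∧
        Sum.elim (fun i => v (.inl i)) (j.insertNth s fun i => v (.inr i)) ∈ Y i})
      (fun i => definable_exists (definable_and ?_ ?_)) (b := j.removeNth b) ?_
    · convert hR.preimage_comp (j.insertNth none fun i => some (.inr i) :
        Fin (k + 1) → Option (Fin n ⊕ Fin k)) using 1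
      ext v
      exact iff_of_eq (congrArg (· ∈ R) (hins v (fun i => some (.inr i)) none))
    · convert (hY i).preimage_comp (Sum.elim (fun i => some (.inl i))
        (j.insertNth none fun i => some (.inr i) : Fin (k + 1) → Option (Fin n ⊕ Fin k))) using 1
      ext v
      rw [mem_preimage, Sum.comp_elim]
      exact iff_of_eq (congrArg (fun u => Sum.elim _ u ∈ Y i)
        (hins v (fun i => some (.inr i)) none))
    · rw [hb]
      congr! 3 with i
      ext x
      simp only [mem_ofPred_eq, Sum.elim_inl, Sum.elim_inr]
      constructor
      · intro hx
        refine ⟨b j, ?_, ?_⟩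
        · simpa using hbR
        · simpa using hx
      · rintro ⟨s, hs, hx⟩
        have : (j.insertNth s fun i => j.removeNth b i : Fin (k + 1) → M) = b := by
          refine hfun _ hs _ hbR fun i hi => ?_
          obtain ⟨i, rfl⟩ := Fin.exists_succAbove_eq hi
          simp [Fin.removeNth]
        rwa [this] at hx

end Main

theorem DclIndependentOver.mono {L : FirstOrder.Language.{u, v}} {M : Type w} [L.Structure M]
    {D D' P : Set M} (hD : DclIndependentOver L D P) (h : D' ⊆ D) : DclIndependentOver L D' P :=
  fun d hd hdcl => hD d (h hd) (Set.Definable.mono hdcl (union_subset_union_right _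
    (sdiff_subset_sdiff_left h)))

theorem mainTheorem4 {L : FirstOrder.Language.{u, v}} {M : Type w}
    [AddCommGroup M] [LinearOrder M] [IsOrderedAddMonoid M]
    [TopologicalSpace M] [OrderTopology M] [L.Structure M]
    (one : M) (hM : IsOMinimalExpansion L one)
    (P D : Set M) (hOP : ConditionOP L P) (hind : ConditionInd L P D)
    (hD : DclIndependentOver L D P)
    (A : Set M) (hA : A ⊆ P) (n : ℕ) (X : Set (Fin n → M)) (hX : InducedDefinable L P D A X) :
    ∃ (l : ℕ) (W S : Fin l → Set (Fin n → M)),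
      (∀ i, (A ∪ D).Definable L (W i)) ∧
      (∀ i, InducedDefinable L P D ∅ (S i)) ∧
      X = ⋃ i, W i ∩ S i := by
  obtain ⟨l, Y, Q, hY, hQ, hXYQ⟩ := hind n X ⟨hX.1, hX.2.mono (preimage_mono hA)⟩
  obtain ⟨k, b, Z, hZ, hYZ⟩ := exists_families_of_definable hY
  have hind' : DclIndependentOver L ((A ∪ D) \ P) P := hD.mono fun d hd =>
    hd.1.resolve_left fun h => hd.2 (hA h)
  obtain ⟨W, hW, hXW⟩ := hM.exists_definable_cover (hOP (A ∪ D) hind') hX.pairDefinable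
    (fun i => InducedDefinable.pairDefinable ⟨(hQ i).1, (hQ i).2.mono
      (preimage_mono (empty_subset A))⟩)
    (fun i => (hZ i).mono (empty_subset _)) (b := b) (hXYQ.trans (by simp only [hYZ]))
  exact ⟨l, W, Q, hW, hQ, hXW⟩
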